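/- Let $G=(V,E)$ be any digraph (possibly infinite, $E\subseteq\{(u,v)\in V\times V: u\ne v\}$), let $p$ be a prime, $R=\mathbb Z_p$ the field with $p$ elements, and $n\ge 0$ an integer. **Path chains.** For $k\ge0$ let $\Lambda_k$ be the free $R$-module on sequences $e_{v_0,\dots,v_k}$ of vertices, $\Lambda_k=0$ for $k<0$, with differential $\partial e_{v_0,\dots,v_k}=\sum_i(-1)^i e_{v_0,\dots,\hat v_i,\dots,v_k}$. A sequence is irregular if two consecutive vertices are equal and allowed if $(v_{i-1},v_i)\in E$ for all $i$. Let $\mathcal A_k$ be the span of the allowed sequences in $\Lambda_k$ modulo the span of the irregular ones, and $\Omega_k=\Omega_k(G;R)=\{x\in\mathcal A_k:\partial x\in\mathcal A_{k-1}\}$. Let $\bar h(x)$ be the set of last vertices of the paths occurring in $x$ with nonzero coefficient. For $u\in V$ let $\delta_u(x)$ be obtained from $x\in\mathcal A_k$ by deleting the last vertex of every path whose last but one vertex is $u$ and dropping the other paths (so $\delta_u=0$ for $k=0$). For $v\in V$ let $[x]^v$ be obtained by appending $v$ to every path of $x$ for which the result is allowed, and dropping the other paths. **Face multihypergraphs.**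 An (upper) face multihypergraph $F$ on $x_1,\dots,x_m\in\Omega_k$ (where $x_i\neq -x_j$ for $i\ne j$; repetitions are allowed) consists of the following. For all $u\in V$ and $i$ with $\delta_u(x_i)\neq0$ there is a chosen decomposition $\delta_u(x_i)=x_i^{u,1}+\dots+x_i^{u,m_i^u}$ in $\Omega_{k-1}$, no nonempty subsequence of which sums to zero. The vertices of $F$ are $1,\dots,m$, vertex $i$ being labeled $x_i$. Each hyperedge of $F$ is labeled by some $u\in V$ and a set of summands $x_{i_1}^{u,k_1},\dots,x_{i_t}^{u,k_t}$ (distinct index pairs $(i_j,k_j)$), joins the vertices $i_1,\dots,i_t$, and is either an *edge*: $t=2$, $i_1\ne i_2$ and $x_{i_1}^{u,k_1}=-x_{i_2}^{u,k_2}$; or has $t\ge3$, the $i_j$ are not all equal, $x_{i_1}^{u,k_1}=\dots=x_{i_t}^{u,k_t}$ and $x_{i_1}^{u,k_1}+\dots+x_{i_t}^{u,k_t}=0$. Every summand $x_i^{u,k}$ appears in at most one hyperedge label. A *mutation* of $F$ is a face multihypergraph with the same $x_i$ and the same decompositions, obtained by one of the following replacements of hyperedges with the same $u$: two edges $\{a,b\},\{c,d\}$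 by $\{a,d\},\{b,c\}$ or by $\{a,c\},\{b,d\}$; two hyperedges $\{a_1,\dots,a_t\},\{b_1,\dots,b_t\}$, $t\ge3$, by the $t$ edges $\{a_j,b_j\}$, or the reverse; two hyperedges of the same size $t\ge3$ by two hyperedges of size $t$ with the same $2t$ summands in total. $F$ is *strongly connected* if every face multihypergraph reachable from $F$ by a finite sequence of mutations (including $F$) is connected as a hypergraph. For $v\in V$, $[x_1+\dots+x_m]^v$ is an *extension by $v$ over $F$* if $(w,v)\in E$ for all $w\in\bar h(x_i)$ and all $i$. It is *$v$-complete* if every hyperedge label has $(u,v)\notin E$ and $u\neq v$, and conversely, for all $i$ and all $u\ne v$ with $\delta_u(x_i)\neq0$ and $(u,v)\notin E$, every $x_i^{u,k}$ appears in a hyperedge label. **Inductive elements.** Let $\bar E^h_{-1}=\emptyset$ and $\bar E^h_0=\{\pm e_v: v\in V\}$. For $k\ge1$ let $\bar E^h_k$ be the set of those $x\in\Omega_k$ with $\bar h(x)=\{v\}$ for some vertex $v$ that are extensions by $v$ over a strongly connected $v$-complete face multihypergraph on some $x_1,\dots,x_m\in\Omega_{k-1}$ such that all $x_i$ lie in $\bar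 E^h_{k-1}$ up to sign and all summands $x_i^{u,l}$ lie in $\bar E^h_{k-2}$ up to sign. These are the $k$-dimensional upper inductive elements. The $k$-dimensional lower inductive elements $\bar E^t_k$ are defined in the same way with first vertices in place of last vertices and all edges reversed (delete the first vertex of the paths whose second vertex is $u$; prepend $v$; require $(v,w)\in E$ for all first vertices $w$ of the $x_i$; replace the conditions on $(u,v)$ by those on $(v,u)$). **Claim.** The upper inductive elements $\bar E^h_n$ span $\Omega_n(G;\mathbb Z_p)$, and so do the lower inductive elements $\bar E^t_n$. Moreover, each of $\bar E^h_n$ and $\bar E^t_n$ contains a subset that is a basis of $\Omega_n(G;\mathbb Z_p)$. -/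

import Mathlib

open scoped BigOperators

namespace DigraphPath

section Chains

variable {V : Type*} (G : Digraph V) (R : Type*) [CommRing R]

/-- The free `R`-module on all finite sequences of elements of `V`. The sequence `[v₀, …, vₙ]`
is the elementary path `e_{v₀,…,vₙ}`, so that the part supported on sequences of length `n + 1`
is the module `Λ_n(V; R)`. -/
abbrev Chain (V : Type*) (R : Type*) [CommRing R] : Type _ := List V →₀ R

/-- The path differential `∂ e_{v₀,…,vₙ} = ∑ᵢ (-1)ⁱ e_{v₀,…,v̂ᵢ,…,vₙ}`, with `∂ e_{v₀} = 0`
since `Λ_{-1} = 0`. -/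
noncomputable def pathDifferential (V : Type*) (R : Type*) [CommRing R] :
    Chain V R →ₗ[R] Chain V R :=
  Finsupp.linearCombination R fun l : List V =>
    if l.length ≤ 1 then 0
    else ∑ i ∈ Finset.range l.length, (-1 : R) ^ i • Finsupp.single (l.eraseIdx i) (1 : R)

/-- The span of the irregular elementary paths: those with two equal consecutive vertices. -/
def irregular (V : Type*) (R : Type*) [CommRing R] : Submodule R (Chain V R) :=
  Finsupp.supported R R {l : List V | ¬ l.IsChain (· ≠ ·)}

/-- `l` is an allowed `n`-path of `G`: a sequence of `n + 1` vertices, `n ≥ 0`, in which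
consecutive vertices are joined by an edge. There is none for `n < 0`. -/
def IsAllowed (n : ℤ) (l : List V) : Prop :=
  l ≠ [] ∧ (l.length : ℤ) = n + 1 ∧ l.IsChain G.Adj

/-- The module `𝒜_n(G; R)`, written through the unique allowed representatives. -/
def allowedChains (n : ℤ) : Submodule R (Chain V R) :=
  Finsupp.supported R R {l : List V | IsAllowed G n l}

/-- The path chains `Ω_n(G; R)`: the `x ∈ 𝒜_n(G; R)` whose path differential, taken in the
quotient by the irregular paths, lies in (the image of) `𝒜_{n-1}(G; R)`.
It is `0` for `n < 0`. -/
noncomputable def pathChains (n : ℤ) : Submodule R (Chain V R) :=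
  allowedChains G R n ⊓
    ((allowedChains G R (n - 1)).map (irregular V R).mkQ).comap
      ((irregular V R).mkQ ∘ₗ pathDifferential V R)

end Chains

/-- Upper constructions work at the last vertex of paths, lower ones at the first vertex. -/
inductive Side : Type
  | upper : Side
  | lower : Side

section Faces

variable {V : Type*} (G : Digraph V) {R : Type*} [CommRing R]

/-- The head set (upper) or the tail set (lower) of a chain: the set of last (first) vertices of
the paths occurring in it. -/
def endSet : Side → Chain V R → Set V
  | Side.upper, x => {v | ∃ l ∈ x.support, l.getLast? = some v}
  | Side.lower, x => {v | ∃ l ∈ x.support, l.head? = some v}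

/-- `w → v` is an edge (upper), respectively `v → w` is an edge (lower). -/
def Joins : Side → V → V → Prop
  | Side.upper, w, v => G.Adj w v
  | Side.lower, w, v => G.Adj v w

open Classical in
/-- The face map `δ^h_{n,u}` (upper): delete the last vertex of those paths whose last but one
vertex is `u`, and drop all other paths. The face map `δ^t_{n,u}` (lower): delete the first
vertex of those paths whose second vertex is `u`. Both vanish on paths with a single vertex. -/
noncomputable def faceMap : Side → V → Chain V R →ₗ[R] Chain V R
  | Side.upper, u => Finsupp.linearCombination R fun l : List V =>
      if l.dropLast.getLast? = some u then Finsupp.single l.dropLast (1 : R) else 0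
  | Side.lower, u => Finsupp.linearCombination R fun l : List V =>
      if l.tail.head? = some u then Finsupp.single l.tail (1 : R) else 0

open Classical in
/-- The upper extension `[x]^v` and the lower extension `[x]_v`: append (prepend) `v` to every
path for which the result is again an allowed path, and drop the other paths. -/
noncomputable def extension : Side → V → Chain V R →ₗ[R] Chain V R
  | Side.upper, v => Finsupp.linearCombination R fun l : List V =>
      if (l ++ [v]).IsChain G.Adj then Finsupp.single (l ++ [v]) (1 : R) else 0
  | Side.lower, v => Finsupp.linearCombination R fun l : List V =>
      if (v :: l).IsChain G.Adj then Finsupp.single (v :: l) (1 : R) else 0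

end Faces

section FaceMultihypergraphs

variable {V : Type*} {G : Digraph V} {R : Type*} [CommRing R] {s : Side} {n : ℤ}

/-- The elements `x_1, …, x_m` of `Ω_n(G; R)` together with the chosen decompositions
`δ_{n,u}(x_i) = x_i^{u,1} + ⋯ + x_i^{u,m_i^u}` in `Ω_{n-1}(G; R)`, no nonempty subsequence of
which sums to zero. (If `δ_{n,u}(x_i) = 0` this forces `m_i^u = 0`.) -/
structure FaceData (G : Digraph V) (R : Type*) [CommRing R] (s : Side) (n : ℤ) where
  m : ℕ
  x : Fin m → Chain V R
  x_mem : ∀ i, x i ∈ pathChains G R n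
  x_ne_neg : ∀ i j, i ≠ j → x i ≠ -x j
  count : Fin m → V → ℕ
  part : (i : Fin m) → (u : V) → Fin (count i u) → Chain V R
  part_mem : ∀ i u k, part i u k ∈ pathChains G R (n - 1)
  sum_part : ∀ i u, ∑ k, part i u k = faceMap s u (x i)
  no_zero_sum : ∀ i u (S : Finset (Fin (count i u))), S.Nonempty → ∑ k ∈ S, part i u k ≠ 0

/-- The index pairs `(i, k)` of the summands `x_i^{u,k}` for a fixed `u`. -/
abbrev FaceData.Slot (D : FaceData G R s n) (u : V) : Type :=
  (i : Fin D.m) × Fin (D.count i u)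

/-- The summand `x_i^{u,k}`. -/
def FaceData.val (D : FaceData G R s n) {u : V} (a : D.Slot u) : Chain V R :=
  D.part a.1 u a.2

/-- Labels `({x_{i_1}^{u,k_1}, …, x_{i_t}^{u,k_t}}, u)`; the summands are recorded by their
indices, as equal chains may occur at several places. The hyperedge carrying the label consists
of the vertices `i_1, …, i_t`. -/
abbrev FaceData.Label (D : FaceData G R s n) : Type _ := (u : V) × Finset (D.Slot u)

/-- The labels that edges may carry: two summands, at distinct vertices, opposite to each
other. -/
def FaceData.IsEdge (D : FaceData G R s n) (e : D.Label) : Prop :=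
  ∃ a b : D.Slot e.1, e.2 = {a, b} ∧ a.1 ≠ b.1 ∧ D.val a = -D.val b

/-- The labels that larger hyperedges may carry: at least three summands, not all at the same
vertex, all equal to each other and with sum zero. -/
def FaceData.IsLargeHyperedge (D : FaceData G R s n) (e : D.Label) : Prop :=
  3 ≤ e.2.card ∧ (∃ a ∈ e.2, ∃ b ∈ e.2, a.1 ≠ b.1) ∧
    (∀ a ∈ e.2, ∀ b ∈ e.2, D.val a = D.val b) ∧ ∑ a ∈ e.2, D.val a = 0

/-- A face multihypergraph on the given data. Its vertices are `Fin D.m`, the vertex `i` being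
labeled by `x_i`. Since a summand appears in at most one hyperedge label, the hyperedges are
given by the set of their labels. -/
structure FaceMultihypergraph (D : FaceData G R s n) where
  edges : Set D.Label
  valid : ∀ e ∈ edges, D.IsEdge e ∨ D.IsLargeHyperedge e
  unique : ∀ (u : V) (S T : Finset (D.Slot u)), (⟨u, S⟩ : D.Label) ∈ edges →
    (⟨u, T⟩ : D.Label) ∈ edges → ∀ a, a ∈ S → a ∈ T → S = T

namespace FaceMultihypergraph

variable {D : FaceData G R s n}

/-- The vertices `i` and `j` lie in a common hyperedge. -/
def Linked (F : FaceMultihypergraph D) (i j : Fin D.m) : Prop :=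
  ∃ e ∈ F.edges, (∃ a ∈ e.2, a.1 = i) ∧ ∃ b ∈ e.2, b.1 = j

/-- Any two vertices are joined by a sequence of hyperedges, consecutive ones of which meet. -/
def Connected (F : FaceMultihypergraph D) : Prop :=
  ∀ i j, Relation.ReflTransGen F.Linked i j

/-- Mutations between face multihypergraphs on the same data. As `{c, d} = {d, c}`, the first
constructor covers both ways of re-pairing two edges. -/
inductive Mutation : FaceMultihypergraph D → FaceMultihypergraph D → Prop
  /-- Edges `{a, b}`, `{c, d}` are replaced by `{a, d}`, `{b, c}`. -/
  | edges (F F' : FaceMultihypergraph D) (u : V) (a b c d : D.Slot u)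
      (h₁ : (⟨u, {a, b}⟩ : D.Label) ∈ F.edges) (h₂ : (⟨u, {c, d}⟩ : D.Label) ∈ F.edges)
      (hab : a ≠ b) (hcd : c ≠ d) (hne : ({a, b} : Finset (D.Slot u)) ≠ {c, d})
      (h : F'.edges = (F.edges \ {⟨u, {a, b}⟩, ⟨u, {c, d}⟩}) ∪ {⟨u, {a, d}⟩, ⟨u, {b, c}⟩}) :
      Mutation F F'
  /-- Two hyperedges of the same size `t ≥ 3` are replaced by `t` edges. -/
  | split (F F' : FaceMultihypergraph D) (u : V) (t : ℕ) (ht : 3 ≤ t) (a b : Fin t ↪ D.Slot u)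
      (h₁ : (⟨u, Finset.univ.map a⟩ : D.Label) ∈ F.edges)
      (h₂ : (⟨u, Finset.univ.map b⟩ : D.Label) ∈ F.edges)
      (hne : Finset.univ.map a ≠ Finset.univ.map b)
      (h : F'.edges = (F.edges \ {⟨u, Finset.univ.map a⟩, ⟨u, Finset.univ.map b⟩}) ∪
        Set.range fun j : Fin t => (⟨u, {a j, b j}⟩ : D.Label)) :
      Mutation F F'
  /-- The reverse replacement. -/
  | merge (F F' : FaceMultihypergraph D) (u : V) (t : ℕ) (ht : 3 ≤ t) (a b : Fin t ↪ D.Slot u)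
      (h₁ : ∀ j : Fin t, (⟨u, {a j, b j}⟩ : D.Label) ∈ F.edges)
      (hne : Finset.univ.map a ≠ Finset.univ.map b)
      (h : F'.edges = (F.edges \ Set.range fun j : Fin t => (⟨u, {a j, b j}⟩ : D.Label)) ∪
        {⟨u, Finset.univ.map a⟩, ⟨u, Finset.univ.map b⟩}) :
      Mutation F F'
  /-- The summands of two hyperedges of the same size `t ≥ 3` are redistributed over two
  hyperedges of size `t`. -/
  | redistribute (F F' : FaceMultihypergraph D) (u : V) (t : ℕ) (ht : 3 ≤ t)
      (S S' T T' : Finset (D.Slot u))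
      (h₁ : (⟨u, S⟩ : D.Label) ∈ F.edges) (h₂ : (⟨u, S'⟩ : D.Label) ∈ F.edges) (hne : S ≠ S')
      (hS : S.card = t) (hS' : S'.card = t) (hT : T.card = t) (hT' : T'.card = t)
      (hdisj : Disjoint T T') (hunion : T ∪ T' = S ∪ S')
      (h : F'.edges = (F.edges \ {⟨u, S⟩, ⟨u, S'⟩}) ∪ {⟨u, T⟩, ⟨u, T'⟩}) :
      Mutation F F'

/-- The face multihypergraph and all face multihypergraphs mutation equivalent to it are
connected. -/
def StronglyConnected (F : FaceMultihypergraph D) : Prop :=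
  ∀ F' : FaceMultihypergraph D, Relation.EqvGen Mutation F F' → F'.Connected

/-- Every hyperedge belongs to some `u ≠ v` not joined to `v`. -/
def Proper (F : FaceMultihypergraph D) (v : V) : Prop :=
  ∀ e ∈ F.edges, ¬ Joins G s e.1 v ∧ e.1 ≠ v

/-- `F` is `v`-proper, and for every `u ≠ v` not joined to `v` each summand `x_i^{u,k}` of a
nonzero `δ_{n,u}(x_i)` appears in a hyperedge label. -/
def Complete (F : FaceMultihypergraph D) (v : V) : Prop :=
  F.Proper v ∧
    ∀ (i : Fin D.m) (u : V), faceMap s u (D.x i) ≠ 0 → u ≠ v → ¬ Joins G s u v →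
      ∀ k : Fin (D.count i u), ∃ S : Finset (D.Slot u),
        (⟨u, S⟩ : D.Label) ∈ F.edges ∧ (⟨i, k⟩ : D.Slot u) ∈ S

end FaceMultihypergraph

/-- The condition for `[x_1 + ⋯ + x_m]^v` (or `[x_1 + ⋯ + x_m]_v`) to be an extension by `v`
over a face multihypergraph: `v` is joined to all heads (tails) of all the `x_i`. -/
def FaceData.Extends (D : FaceData G R s n) (v : V) : Prop :=
  ∀ i, ∀ w ∈ endSet s (D.x i), Joins G s w v

/-- `x` is, up to sign, an element of `E`. -/
def UpToSign (E : Set (Chain V R)) (x : Chain V R) : Prop := x ∈ E ∨ -x ∈ E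

/-- `x ∈ Ω_n(G; R)` is upper (lower) `(E, E')`-inductive, where `E` and `E'` are sets of chains
of dimensions `n - 1` and `n - 2`: it has a unique head (tail) `v`, and it is the upper (lower)
extension by `v` over a strongly connected `v`-complete face multihypergraph whose vertices are
labeled by elements of `± E` and whose decompositions have summands in `± E'`. -/
def IsInductive (G : Digraph V) (s : Side) (n : ℤ) (E E' : Set (Chain V R)) (x : Chain V R) :
    Prop :=
  x ∈ pathChains G R n ∧ ∃ v : V, endSet s x = {v} ∧
    ∃ (D : FaceData G R s (n - 1)) (F : FaceMultihypergraph D),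
      D.Extends v ∧ x = extension G s v (∑ i, D.x i) ∧ F.Complete v ∧ F.StronglyConnected ∧
        (∀ i, UpToSign E (D.x i)) ∧ ∀ i u k, UpToSign E' (D.part i u k)

/-- The `n`-dimensional upper (lower) inductive elements. In dimension `-1` there are none. -/
def inductiveElements (G : Digraph V) (R : Type*) [CommRing R] (s : Side) :
    ℕ → Set (Chain V R)
  | 0 => {x | ∃ v : V, x = Finsupp.single [v] 1 ∨ x = -Finsupp.single [v] 1}
  | 1 => {x | IsInductive G s 1 (inductiveElements G R s 0) ∅ x}
  | n + 2 => {x | IsInductive G s ((n + 2 : ℕ) : ℤ)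
      (inductiveElements G R s (n + 1)) (inductiveElements G R s n) x}

end FaceMultihypergraphs

end DigraphPath

/-! An allowed chain lies in `Ω` exactly when, for all `α`, `β` meeting in two distinct vertices not
joined by an edge, its coefficients on the paths `α w β` add up to zero over `w`
(`mem_pathChains_iff`). Up to sign, that sum is the coefficient of `αβ` in the boundary. The
criterion is symmetric under reversal, so one argument serves both sides.

Grouping paths by last vertex gives `x = ∑ [x_v]^v`. The criterion shows that `x_v ∈ Ω_{n-1}`, and
that `δ_u(x_v) = 0` whenever `u ≠ v` is not joined to `v`. By induction on `n`, `x_v` is a sum of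
inductive elements with ends joined to `v`. Coefficients in `Z_p` become repetitions, and a shortest
such sum has no zero subsum.

Decompose the faces of the summands in a basis `B` taken from the inductive elements two dimensions
lower. For each relevant `u` these faces cancel, so every element of `B` occurs a multiple of `p`
times. Grouping equal summands by `p` yields a complete face multihypergraph
(`FaceData.exists_complete`). If it is strongly connected, the extension is inductive or zero.
Otherwise some mutation of it is disconnected. Mutations preserve completeness, so the faces cancel
separately on two smaller families, and induction on the number of summands finishes
(`extension_sum_mem_span`). -/

namespace DigraphPath

/-! ### Paths seen from either end -/

section Lists

variable {V : Type*}

/-- Attach a vertex at that end of a path at which the constructions of the side operate. -/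
def Side.snoc : Side → List V → V → List V
  | Side.upper, l, v => l ++ [v]
  | Side.lower, l, v => v :: l

/-- The vertex at the end at which the constructions of the side operate. -/
def Side.last? : Side → List V → Option V
  | Side.upper, l => l.getLast?
  | Side.lower, l => l.head?

/-- The vertex at the other end. -/
def Side.first? : Side → List V → Option V
  | Side.upper, l => l.head?
  | Side.lower, l => l.getLast?

/-- The path that runs through `α`, then `w`, then `β`, seen from the side. -/
def Side.insert : Side → List V → List V → V → List V
  | Side.upper, α, β, w => α ++ w :: β
  | Side.lower, α, β, w => β ++ w :: α

namespace Side

variable (s : Side)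

theorem snoc_inj {l l' : List V} {v v' : V} :
    s.snoc l v = s.snoc l' v' ↔ l = l' ∧ v = v' := by
  cases s <;> simp [snoc, and_comm]

theorem snoc_ne_nil (l : List V) (v : V) : s.snoc l v ≠ [] := by
  cases s <;> simp [snoc]

theorem length_snoc (l : List V) (v : V) : (s.snoc l v).length = l.length + 1 := by
  cases s <;> simp [snoc]

theorem exists_eq_snoc {l : List V} (hl : l ≠ []) : ∃ l' v, l = s.snoc l' v := by
  cases s
  · exact ⟨l.dropLast, l.getLast hl, (List.dropLast_append_getLast hl).symm⟩
  · exact ⟨l.tail, l.head hl, (List.cons_head_tail hl).symm⟩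

theorem last?_snoc (l : List V) (v : V) : s.last? (s.snoc l v) = some v := by
  cases s <;> simp [snoc, last?]

theorem first?_snoc {l : List V} (hl : l ≠ []) (v : V) :
    s.first? (s.snoc l v) = s.first? l := by
  cases s <;> cases l <;> simp_all [snoc, first?]

theorem first?_snoc_nil (v : V) : s.first? (s.snoc [] v) = some v := by
  cases s <;> simp [snoc, first?]

theorem first?_nil : s.first? ([] : List V) = none := by
  cases s <;> rfl

theorem last?_nil : s.last? ([] : List V) = none := by
  cases s <;> rfl

theorem insert_snoc (α β : List V) (v w : V) :
    s.insert α (s.snoc β v) w = s.snoc (s.insert α β w) v := by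
  cases s <;> simp [snoc, insert]

theorem insert_nil (α : List V) (w : V) : s.insert α [] w = s.snoc α w := by
  cases s <;> simp [snoc, insert]

theorem insert_injective (α β : List V) : Function.Injective (s.insert α β) := by
  intro w w' h
  cases s <;> simpa [insert] using h

theorem length_insert (α β : List V) (w : V) :
    (s.insert α β w).length = α.length + β.length + 1 := by
  cases s <;> simp [insert] <;> omega

theorem last?_insert (α : List V) {β : List V} (hβ : β ≠ []) (w : V) :
    s.last? (s.insert α β w) = s.last? β := by
  obtain ⟨β', v, rfl⟩ := s.exists_eq_snoc hβ
  rw [insert_snoc, last?_snoc, last?_snoc]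

theorem isChain_snoc (G : Digraph V) (l : List V) (v : V) :
    (s.snoc l v).IsChain G.Adj ↔
      l.IsChain G.Adj ∧ ∀ w, s.last? l = some w → Joins G s w v := by
  cases s
  · simp [snoc, last?, Joins, List.isChain_append]
  · simp [snoc, last?, Joins, List.isChain_cons, and_comm]

end Side

/-- This fails for `n = 0`: one-vertex paths are allowed, the empty list never is. -/
theorem isAllowed_snoc {G : Digraph V} {s : Side} {n : ℤ} {l : List V} {v : V} (hn : 1 ≤ n) :
    IsAllowed G n (s.snoc l v) ↔
      IsAllowed G (n - 1) l ∧ ∀ w, s.last? l = some w → Joins G s w v := by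
  simp only [IsAllowed, s.isChain_snoc, s.length_snoc]
  constructor
  · rintro ⟨-, h, h', h''⟩
    refine ⟨⟨?_, ?_, h'⟩, h''⟩
    · rintro rfl
      simp at h
      omega
    · push_cast at h
      omega
  · rintro ⟨⟨h₁, h₂, h₃⟩, h₄⟩
    refine ⟨s.snoc_ne_nil _ _, ?_, h₃, h₄⟩
    push_cast
    omega

end Lists

/-! ### Gap sums as coefficients of the boundary -/

section Gaps

variable {V : Type*} {R : Type*} [CommRing R]

/-- The sum over all `w` of the coefficients of the paths that run through `α`, `w` and `β`. -/
noncomputable def gap (R : Type*) [CommRing R] (s : Side) (α β : List V) :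
    Chain V R →ₗ[R] R :=
  Finsupp.linearCombination R (fun _ : V => (1 : R)) ∘ₗ
    Finsupp.lcomapDomain (s.insert α β) (s.insert_injective α β)

theorem gap_congr {s t : Side} {α β α' β' : List V} {x y : Chain V R}
    (h : ∀ w, x (s.insert α β w) = y (t.insert α' β' w)) :
    gap R s α β x = gap R t α' β' y := by
  simp only [gap, LinearMap.comp_apply]
  congr 1
  ext w
  exact h w

theorem gap_eq_zero {s : Side} {α β : List V} {x : Chain V R}
    (h : ∀ w, x (s.insert α β w) = 0) : gap R s α β x = 0 :=
  (gap_congr (t := s) (α' := α) (β' := β) (y := 0) h).trans (map_zero _)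

theorem gap_eq_apply {s : Side} {α β : List V} {x : Chain V R} (v : V)
    (h : ∀ w, w ≠ v → x (s.insert α β w) = 0) : gap R s α β x = x (s.insert α β v) := by
  have : Finsupp.lcomapDomain (M := R) (R := R) (s.insert α β) (s.insert_injective α β) x =
      Finsupp.single v (x (s.insert α β v)) := by
    ext w
    rcases eq_or_ne w v with rfl | hw
    · simp [Finsupp.lcomapDomain]
    · rw [Finsupp.single_eq_of_ne hw]
      exact h w hw
  simp [gap, this]

theorem gap_single_insert (s : Side) (α β : List V) (w : V) :
    gap R s α β (Finsupp.single (s.insert α β w) 1) = 1 := by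
  rw [gap_eq_apply w, Finsupp.single_eq_same]
  intro w' hw'
  exact Finsupp.single_eq_of_ne fun h => hw' (s.insert_injective _ _ h)

theorem gap_single_of_forall_ne {s : Side} {α β l : List V} (h : ∀ w, l ≠ s.insert α β w) :
    gap R s α β (Finsupp.single l 1) = 0 :=
  gap_eq_zero fun w => Finsupp.single_eq_of_ne (h w).symm

/-- The vertices at which `α` and `β` meet are distinct and not joined. -/
def IsBadGap (G : Digraph V) (s : Side) (α β : List V) : Prop :=
  ∃ a b, s.last? α = some a ∧ s.first? β = some b ∧ a ≠ b ∧ ¬ Joins G s a b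

theorem isBadGap_lower {G : Digraph V} {α β : List V} :
    IsBadGap G Side.lower α β ↔ IsBadGap G Side.upper β α := by
  constructor <;>
  · rintro ⟨a, b, h₁, h₂, h₃, h₄⟩
    exact ⟨b, a, h₂, h₁, h₃.symm, h₄⟩

theorem IsBadGap.not_isChain {G : Digraph V} {α β : List V}
    (h : IsBadGap G Side.upper α β) : ¬ (α ++ β).IsChain G.Adj := by
  obtain ⟨a, b, ha, hb, -, hab⟩ := h
  intro hc
  exact hab ((List.isChain_append.1 hc).2.2 a ha b hb)

/-- If the deleted vertex stood anywhere but at the junction, the non-edge at the junction would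
already be a step of the allowed path `l`. -/
theorem IsBadGap.eraseIdx_eq_iff {G : Digraph V} {α β l : List V}
    (h : IsBadGap G Side.upper α β) (hl : l.IsChain G.Adj) {i : ℕ} (hi : i < l.length) :
    l.eraseIdx i = α ++ β ↔ i = α.length ∧ ∃ w, l = α ++ w :: β := by
  constructor
  · intro he
    have hsplit : l = l.take i ++ l[i] :: l.drop (i + 1) := by simp
    rw [List.eraseIdx_eq_take_drop_succ] at he
    have hlen : (l.take i).length = i := by simp [hi.le]
    obtain ⟨a, b, ha, hb, -, hab⟩ := h
    -- In each case `γ` is the stretch between the deletion and the junction, and a nonempty `γ`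
    -- leaves `a`, `b` consecutive in `l`.
    rcases List.append_eq_append_iff.1 he with ⟨γ, h₁, h₂⟩ | ⟨γ, h₁, h₂⟩
    · rcases eq_or_ne γ [] with rfl | hγ
      · refine ⟨by rw [h₁]; simp [hi.le], l[i], ?_⟩
        simp only [List.append_nil, List.nil_append] at h₁ h₂
        rw [h₁, ← h₂]
        exact hsplit
      · exfalso
        rw [hsplit, h₂] at hl
        have hl' := (List.isChain_append.1 hl).2.1.tail
        have : γ.getLast? = some a := by
          rw [← ha, h₁]
          simp only [Side.last?]
          rw [List.getLast?_append_of_ne_nil _ hγ]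
        exact hab ((List.isChain_append.1 hl').2.2 a this b hb)
    · rcases eq_or_ne γ [] with rfl | hγ
      · refine ⟨by rw [← hlen, h₁]; simp, l[i], ?_⟩
        simp only [List.append_nil, List.nil_append] at h₁ h₂
        rw [← h₁, h₂]
        exact hsplit
      · exfalso
        rw [hsplit, h₁] at hl
        have hl' := (List.isChain_append.1 hl).1
        have : γ.head? = some b := by
          rw [← hb, h₂]
          simp only [Side.first?]
          rw [List.head?_append_of_ne_nil _ hγ]
        exact hab ((List.isChain_append.1 hl').2.2 a ha b this)
  · rintro ⟨rfl, w, rfl⟩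
    simp [List.eraseIdx_append_of_length_le]

-- Each path `α w β` contributes through a single deletion, at index `α.length`; every other allowed
-- path contributes nothing.
open Classical in
theorem IsBadGap.pathDifferential_apply {G : Digraph V} {α β : List V}
    (h : IsBadGap G Side.upper α β) {n : ℤ} {x : Chain V R} (hx : x ∈ allowedChains G R n) :
    pathDifferential V R x (α ++ β) = (-1) ^ α.length * gap R Side.upper α β x := by
  rw [allowedChains, Finsupp.supported_eq_span_single] at hx
  refine LinearMap.eqOn_span (f := Finsupp.lapply (α ++ β) ∘ₗ pathDifferential V R)
    (g := (-1 : R) ^ α.length • gap R Side.upper α β) ?_ hx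
  rintro _ ⟨l, ⟨-, -, hl⟩, rfl⟩
  have hne : α ≠ [] ∧ β ≠ [] := by
    obtain ⟨a, b, ha, hb, -⟩ := h
    constructor <;> rintro rfl <;> simp [Side.last?, Side.first?] at ha hb
  simp only [LinearMap.comp_apply, LinearMap.smul_apply, Finsupp.lapply_apply, pathDifferential,
    Finsupp.linearCombination_single, one_smul, smul_eq_mul]
  by_cases hw : ∃ w, l = α ++ w :: β
  · obtain ⟨w, rfl⟩ := hw
    -- This avoids the default value `0` of the differential on one-vertex paths.
    have hlen : ¬ (α ++ w :: β).length ≤ 1 := by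
      have := List.length_pos_iff.2 hne.1
      simp only [List.length_append, List.length_cons]
      omega
    have := gap_single_insert (R := R) Side.upper α β w
    simp only [Side.insert] at this
    rw [if_neg hlen, this, Finsupp.finsetSum_apply, Finset.sum_eq_single α.length]
    · simp [List.eraseIdx_append_of_length_le]
    · intro i hi hne
      rw [Finset.mem_range] at hi
      rw [Finsupp.smul_apply, Finsupp.single_eq_of_ne, smul_zero]
      intro he
      exact hne ((h.eraseIdx_eq_iff hl hi).1 he.symm).1
    · intro hmem
      simp at hmem
  · rw [gap_single_of_forall_ne (fun w hl' => hw ⟨w, hl'⟩), mul_zero]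
    split_ifs
    · rfl
    · rw [Finsupp.finsetSum_apply]
      refine Finset.sum_eq_zero fun i hi => ?_
      rw [Finset.mem_range] at hi
      rw [Finsupp.smul_apply, Finsupp.single_eq_of_ne, smul_zero]
      intro he
      exact hw ((h.eraseIdx_eq_iff hl hi).1 he.symm).2

end Gaps

end DigraphPath

namespace DigraphPath

/-! ### Path chains, extensions and faces -/

section PathChains

variable {V : Type*} {G : Digraph V} {R : Type*} [CommRing R] {s : Side} {n : ℤ}

theorem mem_allowedChains {x : Chain V R} :
    x ∈ allowedChains G R n ↔ ∀ l, x l ≠ 0 → IsAllowed G n l := by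
  rw [allowedChains, Finsupp.mem_supported]
  exact ⟨fun h l hl => h (Finsupp.mem_support_iff.2 hl),
    fun h l hl => h l (Finsupp.mem_support_iff.1 hl)⟩

/-- Pulling back the image under the quotient map adds the irregular span. Both modules are
coordinate subspaces, so their sum is the chains supported on the union. -/
theorem mem_pathChains_iff_support {x : Chain V R} :
    x ∈ pathChains G R n ↔ x ∈ allowedChains G R n ∧
      ∀ l, pathDifferential V R x l ≠ 0 → IsAllowed G (n - 1) l ∨ ¬ l.IsChain (· ≠ ·) := by
  rw [pathChains, Submodule.mem_inf, Submodule.comap_comp, Submodule.comap_map_mkQ,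
    Submodule.mem_comap, irregular, allowedChains, allowedChains, ← Finsupp.supported_union,
    Finsupp.mem_supported R (s := _ ∪ _)]
  refine and_congr_right fun _ => ⟨fun h l hl => ?_, fun h l hl => ?_⟩
  · exact (h (Finsupp.mem_support_iff.2 hl)).symm
  · exact (h l (Finsupp.mem_support_iff.1 hl)).symm

theorem length_of_pathDifferential_apply_ne_zero {x : Chain V R}
    (hx : x ∈ allowedChains G R n) {l : List V} (hl : pathDifferential V R x l ≠ 0) :
    l ≠ [] ∧ (l.length : ℤ) = n := by
  classical
  contrapose! hl
  rw [allowedChains, Finsupp.supported_eq_span_single] at hx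
  refine LinearMap.eqOn_span (f := Finsupp.lapply l ∘ₗ pathDifferential V R) (g := 0) ?_ hx
  rintro _ ⟨l', ⟨-, hl', -⟩, rfl⟩
  simp only [LinearMap.comp_apply, Finsupp.lapply_apply, pathDifferential,
    Finsupp.linearCombination_single, one_smul, LinearMap.zero_apply]
  split_ifs with h1
  · rfl
  · rw [Finsupp.finsetSum_apply]
    refine Finset.sum_eq_zero fun i hi => ?_
    rw [Finset.mem_range] at hi
    rw [Finsupp.smul_apply, Finsupp.single_eq_of_ne, smul_zero]
    rintro rfl
    have := List.length_eraseIdx_of_lt hi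
    refine hl ?_ ?_
    · intro h0
      rw [h0] at this
      simp at this
      omega
    · omega

theorem exists_append_of_not_isChain {l : List V} (hl : ¬ l.IsChain G.Adj)
    (hreg : l.IsChain (· ≠ ·)) : ∃ α β, l = α ++ β ∧ IsBadGap G Side.upper α β := by
  simp only [List.isChain_iff_forall_rel_of_append_cons_cons] at hl hreg
  push Not at hl
  obtain ⟨a, b, l₁, l₂, rfl, hab⟩ := hl
  refine ⟨l₁ ++ [a], b :: l₂, by simp, a, b, ?_, rfl, hreg rfl, hab⟩
  simp [Side.last?]

/-- The path chains are cut out of the allowed chains by the gaps that are not edges. -/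
theorem mem_pathChains_iff (hG : ∀ v, ¬ G.Adj v v) (s : Side) {x : Chain V R} :
    x ∈ pathChains G R n ↔ x ∈ allowedChains G R n ∧
      ∀ α β, IsBadGap G s α β → gap R s α β x = 0 := by
  have key : x ∈ pathChains G R n ↔ x ∈ allowedChains G R n ∧
      ∀ α β, IsBadGap G Side.upper α β → gap R Side.upper α β x = 0 := by
    rw [mem_pathChains_iff_support]
    refine and_congr_right fun hx => ⟨fun h α β hb => ?_, fun h l hl => ?_⟩
    · by_cases hreg : (α ++ β).IsChain (· ≠ ·)
      · have h0 : pathDifferential V R x (α ++ β) = 0 := by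
          by_contra hne
          rcases h _ hne with h' | h'
          · exact hb.not_isChain h'.2.2
          · exact h' hreg
        rw [hb.pathDifferential_apply hx] at h0
        rcases neg_one_pow_eq_or R α.length with h1 | h1 <;> simpa [h1] using h0
      -- Here `α ++ β` is irregular and the quotient gives no information. The junction has distinct
      -- vertices, so the repetition lies inside `α` or `β`; as `G` has no loops, no `α w β` is then
      -- allowed.
      · refine gap_eq_zero fun w => ?_
        by_contra hne
        have hc := ((mem_allowedChains.1 hx _ hne).2.2).imp
          (S := (· ≠ ·)) (fun a b hab => by rintro rfl; exact hG _ hab)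
        rw [Side.insert] at hc
        have hc' := List.isChain_append.1 hc
        obtain ⟨a, b, ha, hb', hab, -⟩ := hb
        refine hreg (List.isChain_append.2 ⟨hc'.1, hc'.2.1.tail, fun a' ha' b' hb'' => ?_⟩)
        simp only [Side.last?, Side.first?] at ha hb'
        rw [ha] at ha'
        rw [hb'] at hb''
        cases ha'
        cases hb''
        exact hab
    · by_contra hne
      push Not at hne
      obtain ⟨hlne, hlen⟩ := length_of_pathDifferential_apply_ne_zero hx hl
      have hnc : ¬ l.IsChain G.Adj := fun hc => hne.1 ⟨hlne, by omega, hc⟩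
      obtain ⟨α, β, rfl, hb⟩ := exists_append_of_not_isChain hnc hne.2
      rw [hb.pathDifferential_apply hx, h α β hb, mul_zero] at hl
      exact hl rfl
  cases s
  · exact key
  -- Reversal only exchanges the roles of `α` and `β`.
  · rw [key, forall_comm]
    simp only [isBadGap_lower]
    rfl

theorem mem_endSet {x : Chain V R} {v : V} :
    v ∈ endSet s x ↔ ∃ l, x l ≠ 0 ∧ s.last? l = some v := by
  cases s <;> simp [endSet, Side.last?]

/-- Every end of the chain is joined to `v`. -/
def EndsJoin (G : Digraph V) (s : Side) (x : Chain V R) (v : V) : Prop :=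
  ∀ w ∈ endSet s x, Joins G s w v

theorem extension_apply_snoc_of_ne {v w : V} (h : w ≠ v) (y : Chain V R) (l : List V) :
    extension G s v y (s.snoc l w) = 0 := by
  have h0 : ∀ l', s.snoc l' v ≠ s.snoc l w := fun l' he => h ((s.snoc_inj.1 he).2).symm
  induction y using Finsupp.induction_linear with
  | zero => simp
  | add y z hy hz => rw [map_add, Finsupp.add_apply, hy, hz, add_zero]
  | single l' c =>
    have := h0 l'
    cases s <;> simp only [extension, Finsupp.linearCombination_single] <;> split_ifs <;>
      simp_all [Side.snoc]

theorem extension_apply_nil (v : V) (y : Chain V R) : extension G s v y [] = 0 := by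
  induction y using Finsupp.induction_linear with
  | zero => simp
  | add y z hy hz => rw [map_add, Finsupp.add_apply, hy, hz, add_zero]
  | single l' c =>
    cases s <;> simp only [extension, Finsupp.linearCombination_single] <;> split_ifs <;>
      simp

open Classical in
theorem extension_apply_snoc (v : V) (y : Chain V R) (l : List V) :
    extension G s v y (s.snoc l v) = if (s.snoc l v).IsChain G.Adj then y l else 0 := by
  induction y using Finsupp.induction_linear with
  | zero => simp
  | add y z hy hz =>
    rw [map_add, Finsupp.add_apply, hy, hz, Finsupp.add_apply]
    split_ifs <;> simp
  | single l' c =>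
    rcases eq_or_ne l' l with rfl | hl
    · cases s <;> simp only [extension, Finsupp.linearCombination_single, Side.snoc] <;>
        split_ifs <;> simp_all
    · rw [Finsupp.single_eq_of_ne hl.symm, ite_self]
      cases s <;> simp only [extension, Finsupp.linearCombination_single, Side.snoc] <;>
        split_ifs <;> simp [hl]

theorem extension_apply_snoc_of_endsJoin {v : V} {y : Chain V R}
    (hy : y ∈ allowedChains G R n) (hv : EndsJoin G s y v) (l : List V) :
    extension G s v y (s.snoc l v) = y l := by
  rw [extension_apply_snoc]
  split_ifs with h
  · rfl
  · by_contra hne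
    refine h ((s.isChain_snoc G l v).2 ⟨(mem_allowedChains.1 hy l (Ne.symm hne)).2.2, ?_⟩)
    exact fun w hw => hv w (mem_endSet.2 ⟨l, Ne.symm hne, hw⟩)

-- Faces are gap sums with empty `β`, which makes the vanishing of faces comparable with the gap
-- criterion.
open Classical in
theorem faceMap_apply (u : V) (x : Chain V R) (α : List V) :
    faceMap s u x α = if s.last? α = some u then gap R s α [] x else 0 := by
  induction x using Finsupp.induction_linear with
  | zero => simp
  | add y z hy hz =>
    rw [map_add, Finsupp.add_apply, hy, hz, map_add]
    split_ifs <;> simp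
  | single l c =>
    have hc : Finsupp.single l c = c • Finsupp.single l (1 : R) := by simp
    rw [hc, map_smul, map_smul, Finsupp.smul_apply, ← smul_zero c, ← smul_ite]
    congr 1
    have hf : faceMap s u (Finsupp.single l (1 : R)) = match s with
      | Side.upper => if l.dropLast.getLast? = some u then Finsupp.single l.dropLast 1 else 0
      | Side.lower => if l.tail.head? = some u then Finsupp.single l.tail 1 else 0 := by
      cases s <;> simp only [faceMap, Finsupp.linearCombination_single, one_smul]
    rw [hf]
    by_cases hl : ∃ w, l = s.insert α [] w
    · obtain ⟨w, rfl⟩ := hl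
      rw [gap_single_insert, s.insert_nil]
      cases s
      · by_cases hu : α.getLast? = some u <;> simp [Side.snoc, Side.last?, hu]
      · by_cases hu : α.head? = some u <;> simp [Side.snoc, Side.last?, hu]
    · push Not at hl
      rw [gap_single_of_forall_ne hl, ite_self]
      rcases eq_or_ne l [] with rfl | hne
      · cases s <;> simp
      · obtain ⟨l', v, rfl⟩ := s.exists_eq_snoc hne
        have hα : l' ≠ α := by
          rintro rfl
          exact hl v (s.insert_nil _ _).symm
        cases s
        · by_cases hu : l'.getLast? = some u <;> simp [Side.snoc, hu, hα]
        · by_cases hu : l'.head? = some u <;> simp [Side.snoc, hu, hα]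

/-- Delete the vertex `v` from the paths ending in it, and drop the others. -/
noncomputable def strip (R : Type*) [CommRing R] (s : Side) (v : V) : Chain V R →ₗ[R] Chain V R :=
  Finsupp.lcomapDomain (s.snoc · v) fun _ _ h => (s.snoc_inj.1 h).1

theorem strip_apply (v : V) (x : Chain V R) (l : List V) : strip R s v x l = x (s.snoc l v) :=
  rfl

theorem strip_mem_allowedChains (hn : 1 ≤ n) {x : Chain V R} (hx : x ∈ allowedChains G R n)
    (v : V) : strip R s v x ∈ allowedChains G R (n - 1) :=
  mem_allowedChains.2 fun _ hl => ((isAllowed_snoc hn).1 (mem_allowedChains.1 hx _ hl)).1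

theorem endsJoin_strip (hn : 1 ≤ n) {x : Chain V R} (hx : x ∈ allowedChains G R n)
    (v : V) : EndsJoin G s (strip R s v x) v := by
  intro w hw
  obtain ⟨l, hl, hlw⟩ := mem_endSet.1 hw
  exact ((isAllowed_snoc hn).1 (mem_allowedChains.1 hx _ hl)).2 w hlw

/-- For nonempty `β`, the gap of the stripped chain at `α`, `β` is the gap of `x` at `α`, `β v`,
with the same junction. -/
theorem strip_mem_pathChains (hG : ∀ v, ¬ G.Adj v v) (hn : 1 ≤ n) {x : Chain V R}
    (hx : x ∈ pathChains G R n) (v : V) : strip R s v x ∈ pathChains G R (n - 1) := by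
  rw [mem_pathChains_iff hG s] at hx ⊢
  refine ⟨strip_mem_allowedChains hn hx.1 v, ?_⟩
  rintro α β ⟨a, b, ha, hb, hab⟩
  have hβ : β ≠ [] := by
    rintro rfl
    simp [s.first?_nil] at hb
  rw [← hx.2 α (s.snoc β v) ⟨a, b, ha, by rwa [s.first?_snoc hβ], hab⟩]
  exact gap_congr fun w => by rw [strip_apply, s.insert_snoc]

/-- This is the gap condition on `x` for `β = [v]`, the case in which the junction involves the
removed vertex. -/
theorem faceMap_strip (hG : ∀ v, ¬ G.Adj v v) {x : Chain V R} (hx : x ∈ pathChains G R n)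
    {u v : V} (huv : u ≠ v) (hj : ¬ Joins G s u v) : faceMap s u (strip R s v x) = 0 := by
  ext α
  rw [faceMap_apply]
  split_ifs with h
  · rw [Finsupp.zero_apply, ← ((mem_pathChains_iff hG s).1 hx).2 α (s.snoc [] v)
      ⟨u, v, h, s.first?_snoc_nil v, huv, hj⟩]
    exact gap_congr fun w => by rw [strip_apply, s.insert_snoc]
  · rfl

open Classical in
theorem sum_extension_strip {x : Chain V R} (hx : x ∈ allowedChains G R n) :
    ∑ v ∈ x.support.biUnion (fun l => (s.last? l).toFinset), extension G s v (strip R s v x) =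
      x := by
  ext l
  rw [Finsupp.finsetSum_apply]
  rcases eq_or_ne l [] with rfl | hl
  · rw [Finset.sum_eq_zero fun v _ => extension_apply_nil v _]
    by_contra hne
    exact (mem_allowedChains.1 hx _ (Ne.symm hne)).1 rfl
  · obtain ⟨l, v, rfl⟩ := s.exists_eq_snoc hl
    rw [Finset.sum_eq_single v]
    · rw [extension_apply_snoc, strip_apply]
      split_ifs with h
      · rfl
      · by_contra hne
        exact h (mem_allowedChains.1 hx _ (Ne.symm hne)).2.2
    · exact fun w _ hw => extension_apply_snoc_of_ne hw.symm _ _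
    · intro hv
      rw [extension_apply_snoc, strip_apply, ite_eq_right_iff]
      intro _
      by_contra hne
      refine hv (Finset.mem_biUnion.2 ⟨_, Finsupp.mem_support_iff.2 hne, ?_⟩)
      simp [s.last?_snoc]

/-- Converse to the two conditions on stripped chains: gaps before `v` are gaps of `y`, and gaps at
`v` itself are faces of `y`. -/
theorem extension_mem_pathChains (hG : ∀ v, ¬ G.Adj v v) (hn : 1 ≤ n) {y : Chain V R} {v : V}
    (hy : y ∈ pathChains G R (n - 1)) (hv : EndsJoin G s y v)
    (hface : ∀ u, u ≠ v → ¬ Joins G s u v → faceMap s u y = 0) :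
    extension G s v y ∈ pathChains G R n := by
  rw [mem_pathChains_iff hG s] at hy ⊢
  have happ := extension_apply_snoc_of_endsJoin hy.1 hv
  refine ⟨mem_allowedChains.2 fun l hl => ?_, ?_⟩
  · rcases eq_or_ne l [] with rfl | hne
    · exact absurd (extension_apply_nil v y) hl
    · obtain ⟨l, w, rfl⟩ := s.exists_eq_snoc hne
      rcases eq_or_ne w v with rfl | hw
      · rw [happ] at hl
        exact (isAllowed_snoc hn).2 ⟨mem_allowedChains.1 hy.1 l hl,
          fun a ha => hv a (mem_endSet.2 ⟨l, hl, ha⟩)⟩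
      · exact absurd (extension_apply_snoc_of_ne hw y l) hl
  · rintro α β ⟨a, b, ha, hb, hab, hj⟩
    have hβ : β ≠ [] := by
      rintro rfl
      simp [s.first?_nil] at hb
    obtain ⟨β, w, rfl⟩ := s.exists_eq_snoc hβ
    rcases eq_or_ne w v with rfl | hw
    · have hgap : gap R s α (s.snoc β w) (extension G s w y) = gap R s α β y :=
        gap_congr fun z => by rw [s.insert_snoc, happ]
      rw [hgap]
      rcases eq_or_ne β [] with rfl | hβ
      · rw [s.first?_snoc_nil] at hb
        cases hb
        have := DFunLike.congr_fun (hface a hab hj) α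
        rwa [faceMap_apply, if_pos ha] at this
      · rw [s.first?_snoc hβ] at hb
        exact hy.2 α β ⟨a, b, ha, hb, hab, hj⟩
    · refine gap_eq_zero fun z => ?_
      rw [s.insert_snoc]
      exact extension_apply_snoc_of_ne hw _ _

open Classical in
/-- The part of a chain supported on the paths whose end lies in `W`. -/
noncomputable def restrictEnd (R : Type*) [CommRing R] (s : Side) (W : Set V) :
    Chain V R →ₗ[R] Chain V R :=
  (Submodule.subtype _) ∘ₗ
    Finsupp.restrictDom R R {l : List V | ∃ v ∈ W, s.last? l = some v}

open Classical in
theorem restrictEnd_apply (W : Set V) (x : Chain V R) (l : List V) :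
    restrictEnd R s W x l = if ∃ v ∈ W, s.last? l = some v then x l else 0 := by
  simp [restrictEnd, Finsupp.restrictDom_apply, Finsupp.filter_apply]

/-- In a bad gap `β` is nonempty, so all paths of one gap sum share their end and are kept or
dropped together. -/
theorem restrictEnd_mem_pathChains (hG : ∀ v, ¬ G.Adj v v) (W : Set V) {x : Chain V R}
    (hx : x ∈ pathChains G R n) : restrictEnd R s W x ∈ pathChains G R n := by
  classical
  rw [mem_pathChains_iff hG s] at hx ⊢
  refine ⟨mem_allowedChains.2 fun l hl => mem_allowedChains.1 hx.1 l ?_, ?_⟩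
  · rw [restrictEnd_apply] at hl
    exact fun h => hl (by simp [h])
  · intro α β hb
    have hβ : β ≠ [] := by
      obtain ⟨a, b, ha, hb, hab⟩ := hb
      rintro rfl
      simp [s.first?_nil] at hb
    by_cases hW : ∃ v ∈ W, s.last? β = some v
    · rw [← hx.2 α β hb]
      refine gap_congr fun w => ?_
      rw [restrictEnd_apply, s.last?_insert α hβ, if_pos hW]
    · refine gap_eq_zero fun w => ?_
      rw [restrictEnd_apply, s.last?_insert α hβ, if_neg hW]

theorem faceMap_extension {y : Chain V R} {u v : V} (hy : y ∈ allowedChains G R n)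
    (hv : EndsJoin G s y v) : faceMap s u (extension G s v y) = restrictEnd R s {u} y := by
  classical
  ext α
  rw [faceMap_apply, restrictEnd_apply]
  simp only [Set.mem_singleton_iff, exists_eq_left]
  split_ifs with h
  · rw [gap_eq_apply v, s.insert_nil, extension_apply_snoc_of_endsJoin hy hv]
    intro w hw
    rw [s.insert_nil, extension_apply_snoc_of_ne hw]
  · rfl

theorem faceMap_mem_pathChains (hG : ∀ v, ¬ G.Adj v v) (hn : 0 ≤ n) {x : Chain V R}
    (hx : x ∈ pathChains G R n) (u : V) : faceMap s u x ∈ pathChains G R (n - 1) := by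
  classical
  have hxa := ((mem_pathChains_iff hG s).1 hx).1
  rcases hn.eq_or_lt with rfl | hn'
  · have : faceMap s u x = 0 := by
      ext α
      rw [faceMap_apply, Finsupp.zero_apply, ite_eq_right_iff]
      intro hα
      refine gap_eq_zero fun w => ?_
      by_contra hne
      have hlen := (mem_allowedChains.1 hxa _ hne).2.1
      rw [s.length_insert] at hlen
      have : α = [] := List.length_eq_zero_iff.1 (by push_cast at hlen; omega)
      rw [this, s.last?_nil] at hα
      cases hα
    rw [this]
    exact zero_mem _
  -- The face of an extension by `v` is the part of the stripped chain ending in `u`.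
  · rw [← sum_extension_strip (s := s) hxa, map_sum]
    refine Submodule.sum_mem _ fun v _ => ?_
    rw [faceMap_extension (strip_mem_allowedChains hn' hxa v) (endsJoin_strip hn' hxa v)]
    exact restrictEnd_mem_pathChains hG _ (strip_mem_pathChains hG hn' hx v)

theorem endSet_extension {v : V} {y : Chain V R} (h : extension G s v y ≠ 0) :
    endSet s (extension G s v y) = {v} := by
  have key : ∀ l, extension G s v y l ≠ 0 → s.last? l = some v := by
    intro l hl
    rcases eq_or_ne l [] with rfl | hne
    · exact absurd (extension_apply_nil v y) hl
    · obtain ⟨l, w, rfl⟩ := s.exists_eq_snoc hne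
      rw [s.last?_snoc]
      by_contra hw
      exact hl (extension_apply_snoc_of_ne (fun h => hw (by rw [h])) y l)
  ext w
  rw [mem_endSet, Set.mem_singleton_iff]
  constructor
  · rintro ⟨l, hl, hw⟩
    rw [key l hl] at hw
    exact (Option.some_injective _ hw).symm
  · rintro rfl
    obtain ⟨l, hl⟩ := Finsupp.ne_iff.1 h
    exact ⟨l, hl, key l hl⟩

theorem pathChains_of_neg (hn : n < 0) : pathChains G R n = ⊥ := by
  rw [eq_bot_iff]
  intro x hx
  rw [Submodule.mem_bot]
  ext l
  by_contra hne
  have := (mem_allowedChains.1 (mem_pathChains_iff_support.1 hx).1 l hne)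
  have h1 := List.length_pos_iff.2 this.1
  have h2 := this.2.1
  omega

theorem single_mem_pathChains (hG : ∀ v, ¬ G.Adj v v) (v : V) :
    Finsupp.single [v] (1 : R) ∈ pathChains G R 0 := by
  rw [mem_pathChains_iff hG Side.upper]
  refine ⟨Finsupp.single_mem_supported R 1 (show IsAllowed G 0 [v] by simp [IsAllowed]), ?_⟩
  rintro α β ⟨a, b, ha, -, -⟩
  refine gap_single_of_forall_ne fun w hw => ?_
  have := congrArg List.length hw
  rw [Side.length_insert, List.length_singleton] at this
  have : α = [] := List.length_eq_zero_iff.1 (by omega)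
  rw [this, Side.last?_nil] at ha
  cases ha

theorem span_inductiveElements_zero (hG : ∀ v, ¬ G.Adj v v) :
    Submodule.span R (inductiveElements G R s 0) = pathChains G R 0 := by
  apply le_antisymm
  · rw [Submodule.span_le]
    rintro x ⟨v, rfl | rfl⟩
    · exact single_mem_pathChains hG v
    · exact neg_mem (single_mem_pathChains hG v)
  · intro x hx
    rw [← x.sum_single]
    refine Submodule.sum_mem _ fun l hl => ?_
    have := mem_allowedChains.1 (mem_pathChains_iff_support.1 hx).1 l
      (Finsupp.mem_support_iff.1 hl)
    obtain ⟨v, rfl⟩ := List.length_eq_one_iff.1 (show l.length = 1 by have := this.2.1; omega)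
    rw [← mul_one (x [v]), ← smul_eq_mul, ← Finsupp.smul_single]
    exact Submodule.smul_mem _ _ (Submodule.subset_span ⟨v, Or.inl rfl⟩)

end PathChains

end DigraphPath

namespace DigraphPath

/-! ### Minimal sums and multiplicities modulo `p` -/

section Decompositions

/-- Scalars of `Z_p` are residues of naturals, so spans consist of sums with repetition. In a
shortest sum, a zero subsum could be removed. -/
theorem exists_fin_sum_eq_of_mem_span {p : ℕ} [NeZero p] {M : Type*} [AddCommGroup M]
    [Module (ZMod p) M] {B : Set M} {y : M} (hy : y ∈ Submodule.span (ZMod p) B) :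
    ∃ (m : ℕ) (f : Fin m → M), (∀ i, f i ∈ B) ∧ ∑ i, f i = y ∧
      ∀ S : Finset (Fin m), S.Nonempty → ∑ i ∈ S, f i ≠ 0 := by
  classical
  have hex : ∃ k, ∃ t : Multiset M, t.card = k ∧ (∀ a ∈ t, a ∈ B) ∧ t.sum = y := by
    suffices ∃ t : Multiset M, (∀ a ∈ t, a ∈ B) ∧ t.sum = y by
      obtain ⟨t, ht⟩ := this
      exact ⟨_, t, rfl, ht⟩
    induction hy using Submodule.span_induction with
    | mem a ha => exact ⟨{a}, by simpa using ha, by simp⟩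
    | zero => exact ⟨0, by simp, by simp⟩
    | add a b _ _ ha hb =>
      obtain ⟨t, ht, rfl⟩ := ha
      obtain ⟨t', ht', rfl⟩ := hb
      refine ⟨t + t', fun c hc => ?_, Multiset.sum_add _ _⟩
      exact (Multiset.mem_add.1 hc).elim (ht c) (ht' c)
    | smul c a _ ha =>
      obtain ⟨t, ht, rfl⟩ := ha
      refine ⟨c.val • t, fun b hb => ht b (Multiset.mem_of_mem_nsmul hb), ?_⟩
      rw [Multiset.sum_nsmul, ← Nat.cast_smul_eq_nsmul (ZMod p), ZMod.natCast_zmod_val]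
  obtain ⟨t, htc, htB, hty⟩ := Nat.find_spec hex
  have hmap : Finset.univ.val.map t.toList.get = t := by
    rw [Fin.univ_val_map, List.ofFn_get, Multiset.coe_toList]
  refine ⟨t.toList.length, t.toList.get, fun i => htB _ (Multiset.mem_toList.1 (by simp)), ?_, ?_⟩
  · rw [← hty]
    exact congrArg Multiset.sum hmap
  · intro S hS h0
    have hle : S.val.map t.toList.get ≤ t :=
      (Multiset.map_le_map (Finset.val_le_iff.2 S.subset_univ)).trans_eq hmap
    have hsplit := tsub_add_cancel_of_le hle
    have hcard := congrArg Multiset.card hsplit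
    rw [Multiset.card_add, Multiset.card_map, htc, Finset.card_val] at hcard
    have := hS.card_pos
    refine Nat.find_min hex (m := (t - S.val.map t.toList.get).card) (by omega)
      ⟨_, rfl, fun a ha => htB a (Multiset.mem_of_le tsub_le_self ha), ?_⟩
    have hsum := congrArg Multiset.sum hsplit
    rw [Multiset.sum_add, hty] at hsum
    rw [← hsum]
    exact (add_zero _).symm.trans (congrArg _ h0.symm)

/-- Greedy: split off `p` elements of one fiber; divisibility of all fibers persists. -/
theorem exists_finpartition_fibers {α M : Type*} [DecidableEq α] [DecidableEq M] (f : α → M)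
    {p : ℕ} (hp : p ≠ 0) (A : Finset α) (h : ∀ b, p ∣ (A.filter fun a => f a = b).card) :
    ∃ P : Finpartition A, ∀ T ∈ P.parts, T.card = p ∧ ∀ a ∈ T, ∀ b ∈ T, f a = f b := by
  induction A using Finset.strongInduction with
  | H A ih =>
    rcases A.eq_empty_or_nonempty with rfl | ⟨a, ha⟩
    · exact ⟨Finpartition.empty _, by simp⟩
    · have hpos : 0 < (A.filter fun c => f c = f a).card :=
        Finset.card_pos.2 ⟨a, Finset.mem_filter.2 ⟨ha, rfl⟩⟩
      obtain ⟨T, hT, hTp⟩ := Finset.exists_subset_card_eq (Nat.le_of_dvd hpos (h (f a)))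
      have hTA : T ⊆ A := hT.trans (Finset.filter_subset _ _)
      have hTf : ∀ c ∈ T, f c = f a := fun c hc => (Finset.mem_filter.1 (hT hc)).2
      have hT0 : T ≠ ∅ := by
        rintro rfl
        exact hp hTp.symm
      obtain ⟨P, hP⟩ := ih (A \ T)
        (Finset.sdiff_ssubset hTA (Finset.nonempty_iff_ne_empty.2 hT0)) fun b => by
          have hsdiff : ((A \ T).filter fun c => f c = b) =
              (A.filter fun c => f c = b) \ T.filter fun c => f c = b := by
            ext c
            simp only [Finset.mem_filter, Finset.mem_sdiff]
            tauto
          rw [hsdiff]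
          by_cases hb : f a = b
          · subst hb
            rw [Finset.filter_true_of_mem hTf, Finset.card_sdiff_of_subset hT, hTp]
            exact Nat.dvd_sub (h _) dvd_rfl
          · rw [Finset.filter_false_of_mem fun c hc hcb => hb ((hTf c hc).symm.trans hcb),
              Finset.sdiff_empty]
            exact h b
      refine ⟨P.extend (b := T) hT0 Finset.sdiff_disjoint (Finset.sdiff_union_of_subset hTA),
        fun S hS => ?_⟩
      rcases Finset.mem_insert.1 hS with rfl | hS
      · exact ⟨hTp, fun b hb c hc => (hTf b hb).trans (hTf c hc).symm⟩
      · exact hP S hS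

/-- Collecting equal terms turns the fiber sizes, modulo `p`, into coefficients of a linear
relation. -/
theorem dvd_card_fiber {p : ℕ} {M : Type*} [AddCommGroup M] [DecidableEq M]
    [Module (ZMod p) M] {B : Set M} (hB : LinearIndepOn (ZMod p) id B) {α : Type*} {A : Finset α}
    {f : α → M} (hf : ∀ a ∈ A, f a ∈ B) (h0 : ∑ a ∈ A, f a = 0) (b : M) :
    p ∣ (A.filter fun a => f a = b).card := by
  by_cases hb : b ∈ A.image f
  · rw [← ZMod.natCast_eq_zero_iff]
    refine linearIndepOn_iff'.1 hB (A.image f)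
      (fun b => ((A.filter fun a => f a = b).card : ZMod p)) ?_ ?_ b hb
    · intro c hc
      obtain ⟨a, ha, rfl⟩ := Finset.mem_image.1 hc
      exact hf a ha
    · rw [← h0, Finset.sum_comp (fun c : M => c) f]
      exact Finset.sum_congr rfl fun c _ => Nat.cast_smul_eq_nsmul _ _ _
  · rw [Finset.filter_false_of_mem, Finset.card_empty]
    · exact dvd_zero p
    · rintro a ha rfl
      exact hb (Finset.mem_image_of_mem f ha)

end Decompositions

/-! ### Completeness under mutations and on closed vertex sets -/

namespace FaceMultihypergraph

variable {V : Type*} {G : Digraph V} {R : Type*} [CommRing R] {s : Side} {n : ℤ}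
  {D : FaceData G R s n}

/-- The summand appears in some hyperedge label. -/
def Covers (F : FaceMultihypergraph D) {u : V} (a : D.Slot u) : Prop :=
  ∃ S : Finset (D.Slot u), (⟨u, S⟩ : D.Label) ∈ F.edges ∧ a ∈ S

theorem covers_iff_of_replace {F F' : FaceMultihypergraph D} {X Y : Set D.Label}
    (hX : X ⊆ F.edges) (h : F'.edges = (F.edges \ X) ∪ Y) {u : V} (a : D.Slot u)
    (hXY : (∃ S : Finset (D.Slot u), (⟨u, S⟩ : D.Label) ∈ X ∧ a ∈ S) ↔
      ∃ S : Finset (D.Slot u), (⟨u, S⟩ : D.Label) ∈ Y ∧ a ∈ S) :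
    F.Covers a ↔ F'.Covers a := by
  constructor
  · rintro ⟨S, hS, ha⟩
    by_cases hSX : (⟨u, S⟩ : D.Label) ∈ X
    · obtain ⟨T, hT, haT⟩ := hXY.1 ⟨S, hSX, ha⟩
      exact ⟨T, h ▸ Or.inr hT, haT⟩
    · exact ⟨S, h ▸ Or.inl ⟨hS, hSX⟩, ha⟩
  · rintro ⟨S, hS, ha⟩
    rw [h] at hS
    rcases hS with hS | hS
    · exact ⟨S, hS.1, ha⟩
    · obtain ⟨T, hT, haT⟩ := hXY.2 ⟨S, hS, ha⟩
      exact ⟨T, hX hT, haT⟩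

theorem exists_mem_pair_iff {u u' : V} (a : D.Slot u) (S T : Finset (D.Slot u')) :
    (∃ S' : Finset (D.Slot u), (⟨u, S'⟩ : D.Label) ∈ ({⟨u', S⟩, ⟨u', T⟩} : Set D.Label) ∧
      a ∈ S') ↔ ∃ h : u = u', h ▸ a ∈ S ∪ T := by
  by_cases h : u = u'
  · subst h
    simp [or_and_right, exists_or]
  · simp [h]

theorem exists_mem_range_iff {u u' : V} {t : ℕ} (a : D.Slot u) (S : Fin t → Finset (D.Slot u')) :
    (∃ S' : Finset (D.Slot u), (⟨u, S'⟩ : D.Label) ∈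
      (Set.range fun j => (⟨u', S j⟩ : D.Label)) ∧ a ∈ S') ↔
      ∃ h : u = u', ∃ j, h ▸ a ∈ S j := by
  by_cases h : u = u'
  · subst h
    simp
  · simp [h, Ne.symm h]

/-- A mutation regroups the summands of the hyperedges it replaces, without adding or losing any. -/
theorem Mutation.covers_iff {F F' : FaceMultihypergraph D} (h : Mutation F F') {u : V}
    (a : D.Slot u) : F.Covers a ↔ F'.Covers a := by
  have hpairs : ∀ {u' : V} {t : ℕ} (b c : Fin t ↪ D.Slot u') (a : D.Slot u'),
      (∃ j, a ∈ ({b j, c j} : Finset (D.Slot u'))) ↔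
        a ∈ Finset.univ.map b ∪ Finset.univ.map c := by
    intro u' t b c a
    simp only [Finset.mem_insert, Finset.mem_singleton, exists_or, Finset.mem_union,
      Finset.mem_map, Finset.mem_univ, true_and, eq_comm]
  cases h with
  | edges u' b c d e h₁ h₂ _ _ _ h =>
    refine covers_iff_of_replace (Set.pair_subset h₁ h₂) h a ?_
    rw [exists_mem_pair_iff, exists_mem_pair_iff]
    refine exists_congr fun _ => ?_
    simp only [Finset.mem_union, Finset.mem_insert, Finset.mem_singleton]
    tauto
  | split u' t _ b c h₁ h₂ _ h =>
    refine covers_iff_of_replace (Set.pair_subset h₁ h₂) h a ?_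
    rw [exists_mem_pair_iff, exists_mem_range_iff]
    exact exists_congr fun _ => (hpairs b c _).symm
  | merge u' t _ b c h₁ _ h =>
    refine covers_iff_of_replace (Set.range_subset_iff.2 h₁) h a ?_
    rw [exists_mem_pair_iff, exists_mem_range_iff]
    exact exists_congr fun _ => hpairs b c _
  | redistribute u' t _ S S' T T' h₁ h₂ _ _ _ _ _ _ hunion h =>
    refine covers_iff_of_replace (Set.pair_subset h₁ h₂) h a ?_
    rw [exists_mem_pair_iff, exists_mem_pair_iff, hunion]

theorem nonempty_of_mem_edges (F : FaceMultihypergraph D) {e : D.Label} (he : e ∈ F.edges) :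
    e.2.Nonempty := by
  rcases F.valid e he with ⟨a, b, h, -⟩ | h
  · rw [h]
    exact Finset.insert_nonempty _ _
  · exact Finset.card_pos.1 (by have := h.1; omega)

/-- Completeness depends only on which summands are covered, hence is invariant under mutations. -/
theorem complete_iff {F : FaceMultihypergraph D} {v : V} : F.Complete v ↔
    (∀ (u : V) (a : D.Slot u), F.Covers a → ¬ Joins G s u v ∧ u ≠ v) ∧
      ∀ (i : Fin D.m) (u : V), faceMap s u (D.x i) ≠ 0 → u ≠ v → ¬ Joins G s u v →
        ∀ k : Fin (D.count i u), F.Covers (⟨i, k⟩ : D.Slot u) := by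
  refine and_congr_left fun _ => ⟨fun h u a ⟨S, hS, _⟩ => h _ hS, fun h e he => ?_⟩
  obtain ⟨a, ha⟩ := F.nonempty_of_mem_edges he
  exact h e.1 a ⟨e.2, he, ha⟩

theorem complete_iff_of_eqvGen {F F' : FaceMultihypergraph D}
    (h : Relation.EqvGen Mutation F F') (v : V) : F.Complete v ↔ F'.Complete v := by
  induction h with
  | rel F F' h =>
    rw [complete_iff, complete_iff]
    simp only [h.covers_iff]
  | refl => rfl
  | symm _ _ _ ih => exact ih.symm
  | trans _ _ _ _ _ ih ih' => exact ih.trans ih'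

theorem sum_val_eq_zero (F : FaceMultihypergraph D) {e : D.Label} (he : e ∈ F.edges) :
    ∑ a ∈ e.2, D.val a = 0 := by
  rcases F.valid e he with ⟨a, b, h, hne, hv⟩ | h
  · rw [h, Finset.sum_pair (by rintro rfl; exact hne rfl), hv, neg_add_cancel]
  · exact h.2.2.2

/-- The faces that a complete face multihypergraph has to cancel also cancel over every set of
vertices that is closed under hyperedges. -/
theorem Complete.sum_faceMap_eq_zero {F : FaceMultihypergraph D} {v : V} (hF : F.Complete v)
    {I : Finset (Fin D.m)} (hI : ∀ i ∈ I, ∀ j, F.Linked i j → j ∈ I) {u : V} (huv : u ≠ v)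
    (hj : ¬ Joins G s u v) : ∑ i ∈ I, faceMap s u (D.x i) = 0 := by
  classical
  have hsum : ∑ i ∈ I, faceMap s u (D.x i) =
      ∑ a ∈ I.sigma fun i => (Finset.univ : Finset (Fin (D.count i u))),
        D.val (u := u) a := by
    rw [Finset.sum_sigma]
    exact Finset.sum_congr rfl fun i _ => (D.sum_part i u).symm
  -- The summands over `I` are exhausted by hyperedges inside `I`: completeness covers each one, and
  -- closedness keeps its hyperedge within `I`.
  have hunion : (I.sigma fun i => (Finset.univ : Finset (Fin (D.count i u)))) =
      ((Finset.univ : Finset (Finset (D.Slot u))).filter fun T =>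
        (⟨u, T⟩ : D.Label) ∈ F.edges ∧ ∀ a ∈ T, a.1 ∈ I).biUnion id := by
    ext ⟨i, k⟩
    simp only [Finset.mem_sigma, Finset.mem_univ, and_true, Finset.mem_biUnion,
      Finset.mem_filter, true_and, id]
    constructor
    · intro hi
      have hne : faceMap s u (D.x i) ≠ 0 := by
        rw [← D.sum_part i u]
        exact D.no_zero_sum i u _ ⟨k, Finset.mem_univ k⟩
      obtain ⟨S, hS, hk⟩ := hF.2 i u hne huv hj k
      exact ⟨S, ⟨hS, fun a ha => hI i hi a.1 ⟨_, hS, ⟨_, hk, rfl⟩, a, ha, rfl⟩⟩, hk⟩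
    · rintro ⟨S, ⟨-, hS⟩, hk⟩
      exact hS _ hk
  rw [hsum, hunion, Finset.sum_biUnion]
  · exact Finset.sum_eq_zero fun T hT => F.sum_val_eq_zero (Finset.mem_filter.1 hT).2.1
  · intro S hS T hT hne
    refine Finset.disjoint_left.2 fun a haS haT => hne ?_
    exact F.unique u S T (Finset.mem_filter.1 hS).2.1 (Finset.mem_filter.1 hT).2.1 a haS haT

theorem Linked.symm {F : FaceMultihypergraph D} {i j : Fin D.m} (h : F.Linked i j) :
    F.Linked j i := by
  obtain ⟨e, he, hi, hj⟩ := h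
  exact ⟨e, he, hj, hi⟩

theorem exists_closed_of_not_connected {F : FaceMultihypergraph D} (h : ¬ F.Connected) :
    ∃ I : Finset (Fin D.m), I.Nonempty ∧ Iᶜ.Nonempty ∧
      (∀ i ∈ I, ∀ j, F.Linked i j → j ∈ I) ∧ ∀ i ∈ Iᶜ, ∀ j, F.Linked i j → j ∈ Iᶜ := by
  classical
  simp only [Connected] at h
  push Not at h
  obtain ⟨i, j, hij⟩ := h
  refine ⟨Finset.univ.filter fun k => Relation.ReflTransGen F.Linked i k,
    ⟨i, by simpa using Relation.ReflTransGen.refl⟩, ⟨j, by simpa using hij⟩, ?_, ?_⟩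
  · intro k hk l hl
    simp only [Finset.mem_filter, Finset.mem_univ, true_and] at hk ⊢
    exact hk.tail hl
  · intro k hk l hl
    simp only [Finset.mem_compl, Finset.mem_filter, Finset.mem_univ, true_and] at hk ⊢
    exact fun hl' => hk (hl'.tail hl.symm)

end FaceMultihypergraph

/-! ### Matching the summands -/

section Existence

variable {V : Type*} {G : Digraph V} {s : Side} {n : ℤ} {p : ℕ}

/-- A zero-sum group at one vertex would be a zero subsum of a single decomposition. -/
theorem FaceData.exists_ne_of_sum_val_eq_zero {R : Type*} [CommRing R] {D : FaceData G R s n}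
    {u : V} {T : Finset (D.Slot u)} (hT : T.Nonempty) (h0 : ∑ a ∈ T, D.val a = 0) :
    ∃ a ∈ T, ∃ b ∈ T, a.1 ≠ b.1 := by
  classical
  by_contra! h
  obtain ⟨a, ha⟩ := hT
  have hmap : T = (Finset.univ.filter fun k => (⟨a.1, k⟩ : D.Slot u) ∈ T).map
      (Function.Embedding.sigmaMk a.1) := by
    ext ⟨j, k⟩
    simp only [Finset.mem_map, Finset.mem_filter, Finset.mem_univ, true_and,
      Function.Embedding.sigmaMk_apply]
    constructor
    · intro hk
      obtain rfl : a.1 = j := h a ha _ hk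
      exact ⟨k, hk, rfl⟩
    · rintro ⟨k', hk', h'⟩
      rwa [← h']
  rw [hmap, Finset.sum_map] at h0
  exact D.no_zero_sum a.1 u _ ⟨a.2, by simpa using ha⟩ h0

/-- If the faces of the sum that the extension by `v` has to avoid vanish, and all summands are
taken from a linearly independent set, then the summands can be matched. -/
theorem FaceData.exists_complete [hp : Fact p.Prime] (D : FaceData G (ZMod p) s n)
    {B : Set (Chain V (ZMod p))} (hB : LinearIndepOn (ZMod p) id B)
    (hD : ∀ i u k, D.part i u k ∈ B) {v : V}
    (hface : ∀ u, u ≠ v → ¬ Joins G s u v → ∑ i, faceMap s u (D.x i) = 0) :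
    ∃ F : FaceMultihypergraph D, F.Complete v := by
  classical
  have hP : ∀ u, ∃ P : Finpartition (Finset.univ : Finset (D.Slot u)), u ≠ v →
      ¬ Joins G s u v → ∀ T ∈ P.parts, T.card = p ∧ ∀ a ∈ T, ∀ b ∈ T, D.val a = D.val b := by
    intro u
    by_cases hu : u ≠ v ∧ ¬ Joins G s u v
    · have h0 : ∑ a : D.Slot u, D.val a = 0 := by
        rw [← hface u hu.1 hu.2, Fintype.sum_sigma]
        exact Finset.sum_congr rfl fun i _ => D.sum_part i u
      obtain ⟨P, hP⟩ := exists_finpartition_fibers (D.val (u := u)) hp.out.ne_zero Finset.univ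
        (dvd_card_fiber hB (fun a _ => hD a.1 u a.2) h0)
      exact ⟨P, fun _ _ => hP⟩
    -- An arbitrary value: such `u` carry no hyperedges.
    · exact ⟨⊥, fun h h' => absurd ⟨h, h'⟩ hu⟩
  choose P hP using hP
  refine ⟨⟨{e | e.1 ≠ v ∧ ¬ Joins G s e.1 v ∧ e.2 ∈ (P e.1).parts}, ?_, ?_⟩, ?_, ?_⟩
  · rintro ⟨u, T⟩ ⟨huv, hj, hT⟩
    obtain ⟨hcard, hval⟩ := hP u huv hj T hT
    have hne : T.Nonempty := Finset.card_pos.1 (hp.out.pos.trans_eq hcard.symm)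
    have h0 : ∑ a ∈ T, D.val a = 0 := by
      obtain ⟨b, hb⟩ := hne
      rw [Finset.sum_congr rfl fun a ha => hval a ha b hb, Finset.sum_const, hcard,
        ← Nat.cast_smul_eq_nsmul (ZMod p), CharP.cast_eq_zero, zero_smul]
    obtain ⟨a, ha, b, hb, hab⟩ := D.exists_ne_of_sum_val_eq_zero hne h0
    -- For `p = 2` the groups are edges, as two summands with sum zero are opposite; for larger `p`
    -- they are large hyperedges.
    rcases hp.out.two_le.eq_or_lt with h2 | h3
    · left
      have hT2 : T = {a, b} := by
        refine (Finset.eq_of_subset_of_card_le ?_ ?_).symm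
        · simp [Finset.insert_subset_iff, ha, hb]
        · rw [Finset.card_pair (by rintro rfl; exact hab rfl)]
          exact (hcard.trans h2.symm).le
      refine ⟨a, b, hT2, hab, ?_⟩
      rw [hT2, Finset.sum_pair (by rintro rfl; exact hab rfl)] at h0
      exact eq_neg_of_add_eq_zero_left h0
    · right
      exact ⟨h3.trans_eq hcard.symm, ⟨a, ha, b, hb, hab⟩, hval, h0⟩
  · rintro u S T ⟨-, -, hS⟩ ⟨-, -, hT⟩ a haS haT
    by_contra hne
    exact Finset.disjoint_left.1 ((P u).disjoint hS hT hne) haS haT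
  · rintro e ⟨h₁, h₂, -⟩
    exact ⟨h₂, h₁⟩
  · intro i u _ huv hj k
    obtain ⟨T, hT, hk⟩ := (P u).exists_mem (Finset.mem_univ (⟨i, k⟩ : D.Slot u))
    exact ⟨T, ⟨huv, hj, hT⟩, hk⟩

end Existence

end DigraphPath

namespace DigraphPath

/-! ### Spanning by inductive elements -/

section Span

variable {V : Type*} {G : Digraph V} {s : Side} {n : ℤ} {p : ℕ}

theorem EndsJoin.sum {R : Type*} [CommRing R] {ι : Type*} {I : Finset ι} {x : ι → Chain V R}
    {v : V} (h : ∀ i, EndsJoin G s (x i) v) : EndsJoin G s (∑ i ∈ I, x i) v := by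
  intro w hw
  obtain ⟨l, hl, hlw⟩ := mem_endSet.1 hw
  rw [Finsupp.finsetSum_apply] at hl
  obtain ⟨i, -, hi⟩ := Finset.exists_ne_zero_of_sum_ne_zero hl
  exact h i w (mem_endSet.2 ⟨l, hi, hlw⟩)

theorem extension_sum_mem_span [Fact p.Prime] (hG : ∀ v, ¬ G.Adj v v) (hn : 1 ≤ n)
    {E E' : Set (Chain V (ZMod p))} (hE : E ⊆ pathChains G (ZMod p) (n - 1))
    (hE' : Submodule.span (ZMod p) E' = pathChains G (ZMod p) (n - 1 - 1)) (v : V) (m : ℕ) :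
    ∀ x : Fin m → Chain V (ZMod p), (∀ i, x i ∈ E) → (∀ i j, i ≠ j → x i ≠ -x j) →
      (∀ i, EndsJoin G s (x i) v) →
      (∀ u, u ≠ v → ¬ Joins G s u v → ∑ i, faceMap s u (x i) = 0) →
      extension G s v (∑ i, x i) ∈
        Submodule.span (ZMod p) {x | IsInductive G s n E E' x} := by
  induction m using Nat.strong_induction_on with
  | _ m ih =>
  intro x hxE hneg hends hface
  obtain ⟨B, hBE', hBspan, hB⟩ := exists_linearIndependent (ZMod p) E'
  have hdec : ∀ i u, ∃ (m : ℕ) (f : Fin m → Chain V (ZMod p)), (∀ k, f k ∈ B) ∧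
      ∑ k, f k = faceMap s u (x i) ∧ ∀ S : Finset (Fin m), S.Nonempty → ∑ k ∈ S, f k ≠ 0 := by
    intro i u
    apply exists_fin_sum_eq_of_mem_span (p := p)
    rw [hBspan, hE']
    exact faceMap_mem_pathChains hG (by omega) (hE (hxE i)) u
  choose count part hpart hsum hzero using hdec
  let D : FaceData G (ZMod p) s (n - 1) :=
    { m := m
      x := x
      x_mem := fun i => hE (hxE i)
      x_ne_neg := hneg
      count := count
      part := part
      part_mem := fun i u k => hE' ▸ Submodule.subset_span (hBE' (hpart i u k))
      sum_part := hsum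
      no_zero_sum := hzero }
  obtain ⟨F, hF⟩ := D.exists_complete hB hpart hface
  by_cases hconn : F.StronglyConnected
  -- The zero chain has no end, so it is not inductive, but it lies in the span.
  · rcases eq_or_ne (extension G s v (∑ i, x i)) 0 with h0 | h0
    · rw [h0]
      exact zero_mem _
    · refine Submodule.subset_span ⟨?_, v, endSet_extension h0, D, F, hends, rfl, hF, hconn,
        fun i => Or.inl (hxE i), fun i u k => Or.inl (hBE' (hpart i u k))⟩
      refine extension_mem_pathChains hG hn (Submodule.sum_mem _ fun i _ => hE (hxE i))
        (EndsJoin.sum hends) fun u huv hj => ?_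
      rw [map_sum]
      exact hface u huv hj
  · simp only [FaceMultihypergraph.StronglyConnected] at hconn
    push Not at hconn
    obtain ⟨F', hFF', hF'⟩ := hconn
    have hcomp := (FaceMultihypergraph.complete_iff_of_eqvGen hFF' v).1 hF
    obtain ⟨I, hI, hIc, hclosed, hclosed'⟩ :=
      FaceMultihypergraph.exists_closed_of_not_connected hF'
    -- Only the cancellation of faces over `J` is taken from `F'`; the induction hypothesis builds a
    -- new face multihypergraph on the smaller family.
    have key : ∀ J : Finset (Fin m), Jᶜ.Nonempty →
        (∀ i ∈ J, ∀ j, F'.Linked i j → j ∈ J) → extension G s v (∑ i ∈ J, x i) ∈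
          Submodule.span (ZMod p) {x | IsInductive G s n E E' x} := by
      intro J hJ hJclosed
      have hlt : J.card < m := by
        rw [← Finset.card_compl_lt_iff_nonempty, compl_compl, Fintype.card_fin] at hJ
        exact hJ
      have hreindex : ∀ f : Fin m → Chain V (ZMod p),
          ∑ j, f (J.equivFin.symm j) = ∑ i ∈ J, f i := fun f => by
        rw [← Finset.sum_coe_sort J f]
        exact J.equivFin.symm.sum_comp fun i : J => f i
      have := ih J.card hlt (fun j => x (J.equivFin.symm j)) (fun j => hxE _)
        (fun i j hij => hneg _ _ fun h =>
          hij (J.equivFin.symm.injective (Subtype.ext h))) (fun j => hends _)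
        fun u huv hj => by
          rw [hreindex fun i => faceMap s u (x i)]
          exact hcomp.sum_faceMap_eq_zero hJclosed huv hj
      rwa [hreindex x] at this
    rw [← Finset.sum_add_sum_compl I, map_add]
    exact add_mem (key I hIc hclosed) (key Iᶜ (by rwa [compl_compl]) hclosed')

theorem span_isInductive [Fact p.Prime] (hG : ∀ v, ¬ G.Adj v v) (hn : 1 ≤ n)
    {E E' : Set (Chain V (ZMod p))}
    (hE : Submodule.span (ZMod p) E = pathChains G (ZMod p) (n - 1))
    (hE' : Submodule.span (ZMod p) E' = pathChains G (ZMod p) (n - 1 - 1))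
    (hends : ∀ x ∈ E, ∃ v, endSet s x = {v}) :
    Submodule.span (ZMod p) {x | IsInductive G s n E E' x} = pathChains G (ZMod p) n := by
  classical
  apply le_antisymm
  · exact Submodule.span_le.2 fun x hx => hx.1
  · intro x hx
    have hxa := ((mem_pathChains_iff hG s).1 hx).1
    rw [← sum_extension_strip (s := s) hxa]
    refine Submodule.sum_mem _ fun v _ => ?_
    have hy := strip_mem_pathChains (s := s) hG hn hx v
    have hyj := endsJoin_strip (s := s) hn hxa v
    have hface : ∀ u, u ≠ v → ¬ Joins G s u v → faceMap s u (strip (ZMod p) s v x) = 0 :=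
      fun u huv hj => faceMap_strip hG hx huv hj
    generalize strip (ZMod p) s v x = y at hy hyj hface
    -- Restriction to ends joined to `v` fixes `y`, and keeps or kills each generator because its
    -- end is unique.
    have hyspan : y ∈ Submodule.span (ZMod p) {e ∈ E | EndsJoin G s e v} := by
      have hyr : restrictEnd (ZMod p) s {w | Joins G s w v} y = y := by
        ext l
        rw [restrictEnd_apply, ite_eq_left_iff]
        intro hl
        by_contra hne
        have hlne := (mem_allowedChains.1 ((mem_pathChains_iff hG s).1 hy).1 l (Ne.symm hne)).1
        obtain ⟨l, w, rfl⟩ := s.exists_eq_snoc hlne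
        exact hl ⟨w, hyj w (mem_endSet.2 ⟨_, Ne.symm hne, s.last?_snoc l w⟩), s.last?_snoc l w⟩
      rw [← hyr]
      rw [← hE] at hy
      refine (Submodule.map_span_le _ _ _).2 ?_ ⟨y, hy, rfl⟩
      intro e he
      obtain ⟨w, hw⟩ := hends e he
      have hlast : ∀ l, e l ≠ 0 → s.last? l = some w := by
        intro l hl
        have hel : e ∈ pathChains G (ZMod p) (n - 1) := hE ▸ Submodule.subset_span he
        have hlne := (mem_allowedChains.1 ((mem_pathChains_iff hG s).1 hel).1 l hl).1
        obtain ⟨l, w', rfl⟩ := s.exists_eq_snoc hlne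
        have : w' ∈ endSet s e := mem_endSet.2 ⟨_, hl, s.last?_snoc l w'⟩
        rw [hw] at this
        rw [s.last?_snoc, this]
      by_cases hwv : Joins G s w v
      · have : restrictEnd (ZMod p) s {w | Joins G s w v} e = e := by
          ext l
          rw [restrictEnd_apply, ite_eq_left_iff]
          intro hl
          by_contra hne
          exact hl ⟨w, hwv, hlast l (Ne.symm hne)⟩
        rw [this]
        exact Submodule.subset_span ⟨he, fun w' hw' => by rw [hw] at hw'; exact hw' ▸ hwv⟩
      · have : restrictEnd (ZMod p) s {w | Joins G s w v} e = 0 := by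
          ext l
          rw [restrictEnd_apply, Finsupp.zero_apply, ite_eq_right_iff]
          rintro ⟨w', hw', hl⟩
          by_contra hne
          rw [hlast l hne] at hl
          cases hl
          exact hwv hw'
        rw [this]
        exact zero_mem _
    obtain ⟨m, f, hf, rfl, hzero⟩ := exists_fin_sum_eq_of_mem_span hyspan
    refine extension_sum_mem_span hG hn (fun e he => hE ▸ Submodule.subset_span he) hE' v m f
      (fun i => (hf i).1) (fun i j hij h => ?_) (fun i => (hf i).2) fun u huv hj => ?_
    -- Two opposite summands would form a zero subsum.
    · refine hzero {i, j} ⟨i, by simp⟩ ?_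
      rw [Finset.sum_pair hij, h, neg_add_cancel]
    · rw [← map_sum]
      exact hface u huv hj

theorem exists_endSet_eq_of_mem_inductiveElements {R : Type*} [CommRing R] [Nontrivial R]
    {k : ℕ} {x : Chain V R} (hx : x ∈ inductiveElements G R s k) : ∃ v, endSet s x = {v} := by
  match k, hx with
  | 0, hx =>
    obtain ⟨v, hv⟩ := hx
    refine ⟨v, Set.ext fun w => ?_⟩
    rw [mem_endSet, Set.mem_singleton_iff]
    have hsupp : ∀ l, x l ≠ 0 ↔ l = s.snoc [] v := by
      have hsnoc : s.snoc [] v = [v] := by cases s <;> rfl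
      intro l
      rw [hsnoc]
      rcases hv with rfl | rfl <;> simp [Finsupp.single_apply_ne_zero]
    constructor
    · rintro ⟨l, hl, hlw⟩
      rw [(hsupp l).1 hl, s.last?_snoc] at hlw
      exact (Option.some_injective _ hlw).symm
    · rintro rfl
      exact ⟨_, (hsupp _).2 rfl, s.last?_snoc _ _⟩
  | 1, hx => exact ⟨_, hx.2.choose_spec.1⟩
  | _ + 2, hx => exact ⟨_, hx.2.choose_spec.1⟩

theorem span_inductiveElements [Fact p.Prime] (hG : ∀ v, ¬ G.Adj v v) (s : Side) (k : ℕ) :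
    Submodule.span (ZMod p) (inductiveElements G (ZMod p) s k) = pathChains G (ZMod p) k := by
  induction k using Nat.strong_induction_on with
  | _ k ih =>
  match k, ih with
  | 0, _ => exact span_inductiveElements_zero hG
  | 1, ih =>
    refine span_isInductive hG le_rfl ?_ ?_ fun x => exists_endSet_eq_of_mem_inductiveElements
    · exact ih 0 one_pos
    -- In dimension `-1` the empty set spans, as `Ω_{-1} = 0`.
    · rw [Submodule.span_empty, pathChains_of_neg (by norm_num)]
  | k + 2, ih =>
    refine span_isInductive hG (by omega) ?_ ?_ fun x =>
      exists_endSet_eq_of_mem_inductiveElements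
    · rw [ih (k + 1) (by omega)]
      congr 1
      omega
    · rw [ih k (by omega)]
      congr 1
      omega

theorem exists_basis_subset_of_span_eq {K M : Type*} [Field K] [AddCommGroup M] [Module K M]
    {t : Set M} {W : Submodule K M} (h : Submodule.span K t = W) :
    ∃ B ⊆ t, ∃ b : Module.Basis B K W, ∀ x : B, (b x : M) = x := by
  obtain ⟨B, hBt, hspan, hB⟩ := exists_linearIndependent K t
  have hW : Submodule.span K (Set.range ((↑) : B → M)) = W := by
    rw [Subtype.range_coe, hspan, h]
  refine ⟨B, hBt, (Module.Basis.span hB).map (LinearEquiv.ofEq _ _ hW), fun x => ?_⟩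
  simp [Module.Basis.span_apply]

end Span

end DigraphPath

theorem mainTheorem1 {V : Type*} (G : Digraph V) (hG : ∀ v, ¬ G.Adj v v)
    (p : ℕ) (hp : p.Prime) (n : ℕ) :
    (Submodule.span (ZMod p)
        (DigraphPath.inductiveElements G (ZMod p) DigraphPath.Side.upper n) =
      DigraphPath.pathChains G (ZMod p) n ∧
    Submodule.span (ZMod p)
        (DigraphPath.inductiveElements G (ZMod p) DigraphPath.Side.lower n) =
      DigraphPath.pathChains G (ZMod p) n) ∧
    (∃ B ⊆ DigraphPath.inductiveElements G (ZMod p) DigraphPath.Side.upper n,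
      ∃ b : Module.Basis B (ZMod p) (DigraphPath.pathChains G (ZMod p) n),
        ∀ x : B, (b x : DigraphPath.Chain V (ZMod p)) = x) ∧
    (∃ B ⊆ DigraphPath.inductiveElements G (ZMod p) DigraphPath.Side.lower n,
      ∃ b : Module.Basis B (ZMod p) (DigraphPath.pathChains G (ZMod p) n),
        ∀ x : B, (b x : DigraphPath.Chain V (ZMod p)) = x) := by
  have : Fact p.Prime := ⟨hp⟩
  have h := fun s => DigraphPath.span_inductiveElements (p := p) hG s n
  exact ⟨⟨h _, h _⟩, DigraphPath.exists_basis_subset_of_span_eq (h _),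
    DigraphPath.exists_basis_subset_of_span_eq (h _)⟩
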